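/- Let $p$ be a prime. For power series over a commutative ring, let $A\star B=\sum_{i,j\ge 0}\binom{i+j}{i}\alpha_i\beta_jX^{i+j}$ denote the shuffle product of $A=\sum_n\alpha_nX^n$ and $B=\sum_n\beta_nX^n$. Let $\overline{\mathbb Z}$ be the ring of all algebraic integers in $\overline{\mathbb Q}$. Define $\sigma:\overline{\mathbb F}_p[[X]]\to\overline{\mathbb F}_p[[X]]$ as follows. Given $A\in\overline{\mathbb F}_p[[X]]$, choose a ring homomorphism $\varphi:\overline{\mathbb Z}\to\overline{\mathbb F}_p$ and a lift $\tilde A=\sum_n\tilde\alpha_nX^n\in\overline{\mathbb Z}[[X]]$ of $A$, that is, a series whose image under $\varphi$ (applied to the coefficients) is $A$. The $p$-th shuffle power of $\tilde A$ can be written uniquely as $$\underbrace{\tilde A\star\cdots\star\tilde A}_{p}=\tilde\alpha_0^p+p\sum_{n=1}^\infty\tilde\beta_nX^n\qquad(\tilde\beta_n\in\overline{\mathbb Z}),$$ and $\sigma(A)=\varphi(\tilde\alpha_0)^p+\sum_{n=1}^\infty\varphi(\tilde\beta_n)X^n$; this does not depend on the choices of $\varphi$ and $\tilde A$. A series $A\in\overline{\mathbb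 F}_p[[X]]$ is called rational if $A=f/g$ with $f,g\in\overline{\mathbb F}_p[X]$ and $g(0)\neq 0$, and algebraic if $P(X,A)=0$ for some nonzero polynomial $P\in\overline{\mathbb F}_p[X,Y]$. **Proposition.** For every prime $p$ and every $A\in\overline{\mathbb F}_p[[X]]$: if $A$ is rational, then $\sigma(A)$ is rational; if $A$ is algebraic, then $\sigma(A)$ is algebraic. -/

import Mathlib

namespace ShuffleForm

open PowerSeries

/-- The shuffle product of two power series in one variable:
the coefficient of `X ^ n` is the sum over `i + j = n` of `binom (i + j) i * a_i * b_j`. -/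
noncomputable def shuffle {R : Type*} [CommRing R] (A B : PowerSeries R) : PowerSeries R :=
  PowerSeries.mk fun n => ∑ ij ∈ Finset.HasAntidiagonal.antidiagonal n,
    ((n.choose ij.1 : ℕ) : R) * (coeff ij.1 A * coeff ij.2 B)

/-- The iterated shuffle product of `n` copies of `A` (with value `1` for `n = 0`). -/
noncomputable def shufflePow {R : Type*} [CommRing R] (A : PowerSeries R) : ℕ → PowerSeries R
  | 0 => 1
  | n + 1 => shuffle A (shufflePow A n)

/-- A power series is rational if it is a quotient `f / g` of two polynomials with
`g` invertible as a power series, i.e. `g(0) ≠ 0`. -/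
def IsRational {K : Type*} [Field K] (A : PowerSeries K) : Prop :=
  ∃ f g : Polynomial K, g.coeff 0 ≠ 0 ∧
    A = (f : PowerSeries K) * (g : PowerSeries K)⁻¹

/-- A power series `A` over `K` is algebraic if `P(X, A) = 0` for some nonzero `P` in `K[X][Y]`. -/
def IsAlgebraicSeries {K : Type*} [Field K] (A : PowerSeries K) : Prop :=
  ∃ P : Polynomial (Polynomial K), P ≠ 0 ∧
    P.eval₂ (Polynomial.coeToPowerSeries.ringHom (R := K)) A = 0

/-- The ring of all algebraic integers. -/
abbrev AlgInt : Type := integralClosure ℤ (AlgebraicClosure ℚ)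

/-- An algebraic closure of the field with `p` elements. -/
abbrev FpBar (p : ℕ) [Fact p.Prime] : Type := AlgebraicClosure (ZMod p)

/-- `IsSigma p A B` says that `B` is obtained from `A` in the following way: choose a reduction
homomorphism `φ` from the algebraic integers to an algebraic closure of `F_p` and a lift `A'` of `A`
to a series with algebraic integers as coefficients; write the `p`-th shuffle power of `A'` as
`a₀ ^ p + p * B'`, where `a₀` is the constant coefficient of `A'` and `B'` has no constant
coefficient; then `B` is the reduction of `a₀ ^ p + B'`. -/
def IsSigma (p : ℕ) [Fact p.Prime] (A B : PowerSeries (FpBar p)) : Prop :=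
  ∃ (φ : AlgInt →+* FpBar p) (A' B' : PowerSeries AlgInt),
    PowerSeries.map φ A' = A ∧
    constantCoeff B' = 0 ∧
    shufflePow A' p = C (constantCoeff A' ^ p) + C (p : AlgInt) * B' ∧
    B = PowerSeries.map φ (C (constantCoeff A' ^ p) + B')

section Aux

variable {R S : Type*} [CommRing R] [CommRing S]

/-- The shift `∑ a_n X ^ n ↦ ∑ a_(n+1) X ^ n`, a derivation of the shuffle algebra. -/
noncomputable def shift (A : PowerSeries R) : PowerSeries R :=
  PowerSeries.mk fun n => coeff (n + 1) A

theorem coeff_shuffle (A B : PowerSeries R) (n : ℕ) :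
    coeff n (shuffle A B) = ∑ ij ∈ Finset.HasAntidiagonal.antidiagonal n,
      ((n.choose ij.1 : ℕ) : R) * (coeff ij.1 A * coeff ij.2 B) := by
  simp [shuffle]

theorem coeff_shift (A : PowerSeries R) (n : ℕ) : coeff n (shift A) = coeff (n + 1) A := by
  simp [shift]

theorem shuffle_add (A B D : PowerSeries R) :
    shuffle A (B + D) = shuffle A B + shuffle A D := by
  ext n
  simp only [coeff_shuffle, map_add, mul_add, Finset.sum_add_distrib]

theorem shuffle_comm (A B : PowerSeries R) : shuffle A B = shuffle B A := by
  ext n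
  rw [coeff_shuffle, coeff_shuffle, ← Finset.Nat.sum_antidiagonal_swap]
  refine Finset.sum_congr rfl fun ij h => ?_
  rw [Finset.HasAntidiagonal.mem_antidiagonal] at h
  have : n.choose ij.2 = n.choose ij.1 := Nat.choose_symm_of_eq_add (by omega)
  simp only [Prod.fst_swap, Prod.snd_swap, this]
  ring

theorem add_shuffle (A B D : PowerSeries R) :
    shuffle (A + B) D = shuffle A D + shuffle B D := by
  rw [shuffle_comm, shuffle_add, shuffle_comm D, shuffle_comm D]

theorem shift_shuffle (A B : PowerSeries R) :
    shift (shuffle A B) = shuffle (shift A) B + shuffle A (shift B) := by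
  ext n
  rw [coeff_shift, map_add, coeff_shuffle, coeff_shuffle, coeff_shuffle]
  simp only [coeff_shift]
  have h := Finset.sum_antidiagonal_choose_succ_mul
    (fun i j => coeff i A * coeff j B) n
  rw [h, add_comm]
  congr 1
  refine Finset.sum_congr rfl fun ij h => ?_
  rw [Finset.HasAntidiagonal.mem_antidiagonal] at h
  have : n.choose ij.2 = n.choose ij.1 := Nat.choose_symm_of_eq_add (by omega)
  rw [this]

theorem shuffle_assoc (A B D : PowerSeries R) :
    shuffle (shuffle A B) D = shuffle A (shuffle B D) := by
  ext n
  induction n generalizing A B D with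
  | zero => simp [coeff_shuffle, mul_assoc]
  | succ n ih =>
    rw [← coeff_shift, ← coeff_shift]
    simp only [shift_shuffle, add_shuffle, shuffle_add, map_add, ih, add_assoc]

theorem shuffle_natCast_mul (A B : PowerSeries R) (k : ℕ) :
    shuffle A (C (k : R) * B) = C (k : R) * shuffle A B := by
  ext n
  simp only [coeff_shuffle, coeff_C_mul, Finset.mul_sum]
  exact Finset.sum_congr rfl fun _ _ => by ring

theorem shift_shufflePow_succ (A : PowerSeries R) (n : ℕ) :
    shift (shufflePow A (n + 1)) =
      C ((n + 1 : ℕ) : R) * shuffle (shift A) (shufflePow A n) := by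
  induction n with
  | zero =>
    have h1 : shift (1 : PowerSeries R) = 0 := by
      ext m
      simp [coeff_shift, PowerSeries.coeff_one]
    have h2 : shuffle A (0 : PowerSeries R) = 0 := by
      ext m
      simp [coeff_shuffle]
    simp [shufflePow, shift_shuffle, h1, h2]
  | succ n ih =>
    have h : shufflePow A (n + 1 + 1) = shuffle A (shufflePow A (n + 1)) := rfl
    rw [h, shift_shuffle, ih, shuffle_natCast_mul, ← shuffle_assoc, shuffle_comm A (shift A),
      shuffle_assoc]
    have h' : shuffle A (shufflePow A n) = shufflePow A (n + 1) := rfl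
    rw [h']
    push_cast
    simp only [map_add, map_one]
    ring

theorem constantCoeff_shufflePow (A : PowerSeries R) (n : ℕ) :
    coeff 0 (shufflePow A n) = coeff 0 A ^ n := by
  induction n with
  | zero => simp [shufflePow]
  | succ n ih =>
    rw [coeff_zero_eq_constantCoeff_apply, coeff_zero_eq_constantCoeff_apply] at ih
    rw [shufflePow, coeff_shuffle]
    simp [ih, pow_succ, mul_comm]

theorem map_shuffle (f : R →+* S) (A B : PowerSeries R) :
    PowerSeries.map f (shuffle A B) = shuffle (PowerSeries.map f A) (PowerSeries.map f B) := by
  ext n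
  simp [coeff_shuffle, map_sum]

theorem map_shufflePow (f : R →+* S) (A : PowerSeries R) (n : ℕ) :
    PowerSeries.map f (shufflePow A n) = shufflePow (PowerSeries.map f A) n := by
  induction n with
  | zero => simp [shufflePow]
  | succ n ih => simp [shufflePow, map_shuffle, ih]

/-- The decomposition `A ^ p = a₀ ^ p + p * B` of a `p`-th shuffle power. -/
theorem exists_shufflePow_eq (A : PowerSeries R) {p : ℕ} (hp : 0 < p) :
    ∃ B : PowerSeries R, constantCoeff B = 0 ∧
      shufflePow A p = C (constantCoeff A ^ p) + C (p : R) * B := by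
  obtain ⟨k, rfl⟩ : ∃ k, p = k + 1 := ⟨p - 1, by omega⟩
  refine ⟨X * shuffle (shift A) (shufflePow A k), by simp, ?_⟩
  ext n
  cases n with
  | zero => rw [constantCoeff_shufflePow]; simp
  | succ n =>
    rw [← coeff_shift, shift_shufflePow_succ, map_add, coeff_C_mul, coeff_C_mul,
      coeff_succ_X_mul, coeff_C, if_neg (Nat.succ_ne_zero n), zero_add]

/-- Reductions of the quotients `B'` depend only on the reduction of the lift `A'`. -/
theorem map_quotient_eq {p : ℕ} (hp : 0 < p) (φ : AlgInt →+* S) (A' B' : PowerSeries AlgInt)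
    (D : PowerSeries (MvPolynomial ℕ ℤ))
    (hD : shufflePow (PowerSeries.mk fun n => (MvPolynomial.X n : MvPolynomial ℕ ℤ)) p =
      C (MvPolynomial.X 0 ^ p) + C ((p : ℕ) : MvPolynomial ℕ ℤ) * D)
    (h : shufflePow A' p = C (constantCoeff A' ^ p) + C (p : AlgInt) * B') :
    PowerSeries.map φ B' = PowerSeries.map
      (MvPolynomial.eval₂Hom (Int.castRingHom S) fun n => φ (coeff n A')) D := by
  let ψ : MvPolynomial ℕ ℤ →+* AlgInt :=
    MvPolynomial.eval₂Hom (Int.castRingHom AlgInt) fun n => coeff n A'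
  have hA : PowerSeries.map ψ
      (PowerSeries.mk fun n => (MvPolynomial.X n : MvPolynomial ℕ ℤ)) = A' := by
    ext n
    simp [ψ]
  have h0 : ψ (MvPolynomial.X 0) = constantCoeff A' := by simp [ψ]
  have h1 := congrArg (PowerSeries.map ψ) hD
  rw [map_shufflePow, hA, h, map_add, map_mul, map_C, map_C, map_pow ψ, h0, map_natCast] at h1
  have h2 : B' = PowerSeries.map ψ D := by
    ext n
    have h3 := congrArg (coeff n) (add_left_cancel h1)
    rw [← map_natCast (C (R := AlgInt)), map_natCast ψ, coeff_C_mul, coeff_C_mul] at h3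
    have hp' : (p : AlgInt) ≠ 0 := Nat.cast_ne_zero.mpr hp.ne'
    exact congrArg _ (mul_left_cancel₀ hp' h3)
  have h4 : φ.comp ψ = MvPolynomial.eval₂Hom (Int.castRingHom S) fun n => φ (coeff n A') := by
    apply MvPolynomial.ringHom_ext
    · intro r
      simp [ψ]
    · intro i
      simp [ψ]
  rw [h2, ← h4]
  ext n
  simp

end Aux

/-- A reduction homomorphism exists. -/
theorem exists_reduction (p : ℕ) [Fact p.Prime] : Nonempty (AlgInt →+* FpBar p) := by
  have hp : p.Prime := Fact.out
  have hmax : (Ideal.span {(p : ℤ)}).IsMaximal :=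
    PrincipalIdealRing.isMaximal_of_irreducible (Nat.prime_iff_prime_int.mp hp).irreducible
  have hinj : Function.Injective (algebraMap ℤ AlgInt) := by
    intro a b hab
    simpa using hab
  obtain ⟨M, hM, hMp⟩ := Ideal.exists_ideal_over_maximal_of_isIntegral (S := AlgInt)
    (Ideal.span {(p : ℤ)}) (by
      rw [(RingHom.injective_iff_ker_eq_bot _).mp hinj]
      exact bot_le)
  let : Field (AlgInt ⧸ M) := Ideal.Quotient.field M
  have hpM : ((p : ℕ) : AlgInt ⧸ M) = 0 := by
    have h1 : (p : ℤ) ∈ M.comap (algebraMap ℤ AlgInt) := by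
      rw [hMp]
      exact Ideal.mem_span_singleton_self _
    have h2 := Ideal.Quotient.eq_zero_iff_mem.mpr (Ideal.mem_comap.mp h1)
    simpa using h2
  have : CharP (AlgInt ⧸ M) p := by
    refine (CharP.charP_iff_prime_eq_zero hp).mpr hpM
  let : Algebra (ZMod p) (AlgInt ⧸ M) := ZMod.algebra _ p
  have : Algebra.IsIntegral ℤ (AlgInt ⧸ M) := inferInstance
  have : IsScalarTower ℤ (ZMod p) (AlgInt ⧸ M) :=
    IsScalarTower.of_algebraMap_eq' (RingHom.ext_int _ _)
  have : Algebra.IsIntegral (ZMod p) (AlgInt ⧸ M) :=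
    Algebra.IsIntegral.tower_top ℤ
  have : Algebra.IsAlgebraic (ZMod p) (AlgInt ⧸ M) := inferInstance
  let j : (AlgInt ⧸ M) →ₐ[ZMod p] FpBar p := IsAlgClosed.lift
  exact ⟨j.toRingHom.comp (Ideal.Quotient.mk M)⟩

/-- Every reduction homomorphism is surjective, so lifts exist. -/
theorem reduction_surjective (p : ℕ) [Fact p.Prime] (φ : AlgInt →+* FpBar p) :
    Function.Surjective φ := by
  intro x
  have hx : IsIntegral (ZMod p) x := Algebra.IsIntegral.isIntegral x
  obtain ⟨f, hf, -, hfmo⟩ := Polynomial.lifts_and_natDegree_eq_and_monic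
    (f := Int.castRingHom (ZMod p)) (p := minpoly (ZMod p) x)
    ((Polynomial.mem_lifts _).mpr (Polynomial.map_surjective _ ZMod.intCast_surjective _))
    (minpoly.monic hx)
  have hs : (f.map (Int.castRingHom AlgInt)).Splits := by
    refine Polynomial.Splits.of_splits_map_of_injective
      (i := algebraMap AlgInt (AlgebraicClosure ℚ)) Subtype.val_injective
      (IsAlgClosed.splits _) fun a ha => ?_
    have ha' := Polynomial.isRoot_of_mem_roots ha
    rw [Polynomial.map_map, Polynomial.IsRoot.def, Polynomial.eval_map] at ha'
    rw [RingHom.ext_int ((algebraMap AlgInt (AlgebraicClosure ℚ)).comp (Int.castRingHom AlgInt))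
      (algebraMap ℤ (AlgebraicClosure ℚ))] at ha'
    exact ⟨⟨a, f, hfmo, ha'⟩, rfl⟩
  have hev : f.eval₂ (Int.castRingHom (FpBar p)) x = 0 := by
    have h1 := minpoly.aeval (ZMod p) x
    rw [← hf, Polynomial.aeval_def, Polynomial.eval₂_map, RingHom.ext_int
      ((algebraMap (ZMod p) (FpBar p)).comp (Int.castRingHom (ZMod p)))
      (Int.castRingHom (FpBar p))] at h1
    exact h1
  have hmap : (f.map (Int.castRingHom AlgInt)).map φ = f.map (Int.castRingHom (FpBar p)) := by
    rw [Polynomial.map_map, RingHom.ext_int (φ.comp (Int.castRingHom AlgInt))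
      (Int.castRingHom (FpBar p))]
  have hroot : x ∈ ((f.map (Int.castRingHom AlgInt)).map φ).roots := by
    rw [hmap, Polynomial.mem_roots (hfmo.map _).ne_zero, Polynomial.IsRoot.def,
      Polynomial.eval_map, hev]
  rw [hs.eq_prod_roots_of_monic (hfmo.map _), Polynomial.map_multiset_prod] at hroot
  simp only [Multiset.map_map, Function.comp_def, Polynomial.map_sub, Polynomial.map_X,
    Polynomial.map_C] at hroot
  have h2 : ((f.map (Int.castRingHom AlgInt)).roots.map
      fun r => (Polynomial.X - Polynomial.C (φ r))) =
      ((f.map (Int.castRingHom AlgInt)).roots.map φ).map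
        fun r => (Polynomial.X - Polynomial.C r) := by
    rw [Multiset.map_map]
    rfl
  rw [h2, Polynomial.roots_multiset_prod_X_sub_C] at hroot
  obtain ⟨r, -, hr⟩ := Multiset.mem_map.mp hroot
  exact ⟨r, hr⟩

/-- The series `B` in the definition of `IsSigma` exists and does not depend on any choice. -/
theorem existsUnique_isSigma (p : ℕ) [Fact p.Prime] (A : PowerSeries (FpBar p)) :
    ∃! B, IsSigma p A B := by
  have hp : 0 < p := (Fact.out : p.Prime).pos
  obtain ⟨D, -, hD⟩ := exists_shufflePow_eq
    (PowerSeries.mk fun n => (MvPolynomial.X n : MvPolynomial ℕ ℤ)) hp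
  have hD' : shufflePow (PowerSeries.mk fun n => (MvPolynomial.X n : MvPolynomial ℕ ℤ)) p =
      C (MvPolynomial.X 0 ^ p) + C ((p : ℕ) : MvPolynomial ℕ ℤ) * D := by
    rw [hD]
    simp [← coeff_zero_eq_constantCoeff_apply]
  apply existsUnique_of_exists_of_unique
  · obtain ⟨φ⟩ := exists_reduction p
    choose l hl using reduction_surjective p φ
    obtain ⟨B', h0, hB'⟩ := exists_shufflePow_eq
      (PowerSeries.mk fun n => l (coeff n A)) hp
    exact ⟨_, φ, _, B', by ext n; simp [hl], h0, hB', rfl⟩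
  · rintro B₁ B₂ ⟨φ₁, A₁, D₁, hA₁, -, h₁, rfl⟩ ⟨φ₂, A₂, D₂, hA₂, -, h₂, rfl⟩
    have e : ∀ n, φ₁ (coeff n A₁) = φ₂ (coeff n A₂) := fun n => by
      rw [← coeff_map, ← coeff_map, hA₁, hA₂]
    have e0 : φ₁ (constantCoeff A₁) = φ₂ (constantCoeff A₂) := by simpa using e 0
    rw [map_add, map_add, map_quotient_eq hp φ₁ A₁ D₁ D hD' h₁,
      map_quotient_eq hp φ₂ A₂ D₂ D hD' h₂]
    simp only [map_C, map_pow, e, e0]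

/-- The `p`-homogeneous form `σ`. -/
noncomputable def sigma (p : ℕ) [Fact p.Prime] (A : PowerSeries (FpBar p)) :
    PowerSeries (FpBar p) :=
  Classical.choose (existsUnique_isSigma p A).exists

/-- `σ(A)` can be computed from any reduction homomorphism and any lift. -/
theorem sigma_eq_iff (p : ℕ) [Fact p.Prime] (A B : PowerSeries (FpBar p)) :
    sigma p A = B ↔ IsSigma p A B := by
  have h : IsSigma p A (sigma p A) := Classical.choose_spec (existsUnique_isSigma p A).exists
  exact ⟨fun e => e ▸ h, fun hB => (existsUnique_isSigma p A).unique h hB⟩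

end ShuffleForm

/-! The shift is a derivation of the shuffle algebra, so the shift of the `p`-th shuffle power of a
lift is `p` times (shift of the lift) ⋆ (its `(p-1)`-th shuffle power). The division by `p` is thus
explicit, and `sigma_eq` expresses `σ(A)` over the residue field through shift, shuffle and
multiplication by `X`. It remains to see that shuffling preserves rationality and algebraicity.

Both are finiteness properties. A series is rational iff it lies in a finite-dimensional
shift-stable space (`IsRational.exists_fg`, `isRational_of_fg`); over a perfect field of
characteristic `p` it is algebraic iff it lies in a finite-dimensional space stable under the
Cartier operators, a form of Christol's theorem (`isCartierFinite_of_isAlgebraic`,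
`isAlgebraic_of_isCartierFinite`). If `V` and `W` are such spaces for `A` and `B`, the span of all
`D ⋆ E` with `D ∈ V`, `E ∈ W` is one for `A ⋆ B`: by the Leibniz rule for the shift, and by Lucas'
theorem for the Cartier operators (`cartier_shuffle`). -/

namespace ShuffleForm

open PowerSeries

/-! ### Bilinearity of the shuffle product; polynomials of bounded degree -/

section Shuffle

variable {R : Type*} [CommRing R]

theorem smul_shuffle (c : R) (A B : PowerSeries R) : shuffle (c • A) B = c • shuffle A B := by
  ext n
  simp only [coeff_shuffle, coeff_smul, Finset.mul_sum, smul_eq_mul]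
  exact Finset.sum_congr rfl fun _ _ => by ring

theorem shuffle_smul (c : R) (A B : PowerSeries R) : shuffle A (c • B) = c • shuffle A B := by
  rw [shuffle_comm, smul_shuffle, shuffle_comm]

/-- The shuffle product as a bilinear map. -/
noncomputable def shuffleBilin (R : Type*) [CommRing R] :
    PowerSeries R →ₗ[R] PowerSeries R →ₗ[R] PowerSeries R :=
  LinearMap.mk₂ R shuffle add_shuffle smul_shuffle shuffle_add shuffle_smul

theorem shuffleBilin_apply (A B : PowerSeries R) : shuffleBilin R A B = shuffle A B := rfl

/-- The shift as a linear map. -/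
noncomputable def shiftLinear (R : Type*) [CommRing R] : PowerSeries R →ₗ[R] PowerSeries R where
  toFun := shift
  map_add' A B := by ext n; simp [coeff_shift]
  map_smul' c A := by ext n; simp [coeff_shift]

theorem shiftLinear_apply (A : PowerSeries R) : shiftLinear R A = shift A := rfl

theorem X_mul_shift (A : PowerSeries R) : X * shift A = A - C (constantCoeff A) := by
  ext n
  cases n with
  | zero => simp
  | succ n => simp [coeff_succ_X_mul, coeff_shift]

theorem map_shift {S : Type*} [CommRing S] (f : R →+* S) (A : PowerSeries R) :
    PowerSeries.map f (shift A) = shift (PowerSeries.map f A) := by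
  ext n
  simp [coeff_shift]

/-- The power series that are polynomials of degree at most `N`. -/
def polyLE (R : Type*) [CommRing R] (N : ℕ) : Submodule R (PowerSeries R) where
  carrier := {f | ∀ n, N < n → coeff n f = 0}
  zero_mem' _ _ := map_zero _
  add_mem' hf hg n hn := by rw [map_add, hf n hn, hg n hn, add_zero]
  smul_mem' c f hf n hn := by rw [coeff_smul, hf n hn, smul_zero]

theorem polyLE_mono {M N : ℕ} (h : M ≤ N) : polyLE R M ≤ polyLE R N :=
  fun _ hf n hn => hf n (h.trans_lt hn)

theorem mul_mem_polyLE {f g : PowerSeries R} {M N : ℕ} (hf : f ∈ polyLE R M)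
    (hg : g ∈ polyLE R N) : f * g ∈ polyLE R (M + N) := by
  intro n hn
  rw [coeff_mul]
  refine Finset.sum_eq_zero fun ij h => ?_
  rw [Finset.HasAntidiagonal.mem_antidiagonal] at h
  rcases lt_or_ge M ij.1 with h1 | h1
  · rw [hf _ h1, zero_mul]
  · rw [hg _ (by omega), mul_zero]

theorem pow_mem_polyLE {f : PowerSeries R} {N : ℕ} (hf : f ∈ polyLE R N) (k : ℕ) :
    f ^ k ∈ polyLE R (k * N) := by
  induction k with
  | zero =>
    intro n hn
    rw [pow_zero, coeff_one, if_neg (by omega)]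
  | succ k ih =>
    rw [pow_succ, Nat.succ_mul]
    exact mul_mem_polyLE ih hf

theorem coe_mem_polyLE {f : Polynomial R} {N : ℕ} (h : f.natDegree ≤ N) :
    (f : PowerSeries R) ∈ polyLE R N := by
  intro n hn
  rw [Polynomial.coeff_coe]
  exact Polynomial.coeff_eq_zero_of_natDegree_lt (h.trans_lt hn)

theorem exists_coe_eq_of_mem_polyLE {f : PowerSeries R} {N : ℕ} (h : f ∈ polyLE R N) :
    ∃ g : Polynomial R, (g : PowerSeries R) = f := by
  refine ⟨trunc (N + 1) f, ?_⟩
  ext n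
  rw [Polynomial.coeff_coe, coeff_trunc]
  split_ifs with hn
  · rfl
  · exact (h n (by omega)).symm

instance polyLE_finite [IsNoetherianRing R] (N : ℕ) : Module.Finite R (polyLE R N) := by
  let e : polyLE R N →ₗ[R] (Fin (N + 1) → R) :=
    { toFun := fun f i => coeff (i : ℕ) (f : PowerSeries R)
      map_add' := fun f g => by ext i; simp
      map_smul' := fun c f => by ext i; simp }
  refine Module.Finite.of_injective e fun f g h => Subtype.ext ?_
  ext n
  rcases lt_or_ge N n with hn | hn
  · rw [f.2 n hn, g.2 n hn]
  · exact congrFun h ⟨n, by omega⟩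

end Shuffle

/-! ### Rational series and shift-stable spaces -/

section Rational

variable {K : Type*} [Field K]

/-- The space of all series `A` with `Q * A` in a given finite-dimensional space is
finite-dimensional. -/
theorem fg_comap_mulLeft {Q : PowerSeries K} (hQ : Q ≠ 0) (T : Submodule K (PowerSeries K))
    [Module.Finite K T] : (T.comap (LinearMap.mulLeft K Q)).FG := by
  rw [← Module.Finite.iff_fg]
  let e : T.comap (LinearMap.mulLeft K Q) →ₗ[K] T :=
    (LinearMap.mulLeft K Q).restrict fun _ h => h
  refine Module.Finite.of_injective e fun f g h => Subtype.ext ?_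
  exact mul_left_cancel₀ hQ (congrArg Subtype.val h)

theorem isRational_iff_mul {A : PowerSeries K} :
    IsRational A ↔ ∃ f g : Polynomial K, g.coeff 0 ≠ 0 ∧ (g : PowerSeries K) * A = f := by
  have key (g : Polynomial K) (h : g.coeff 0 ≠ 0) :
      constantCoeff (g : PowerSeries K) ≠ 0 := by simpa using h
  constructor
  · rintro ⟨f, g, hg, rfl⟩
    refine ⟨f, g, hg, ?_⟩
    rw [mul_left_comm, PowerSeries.mul_inv_cancel _ (key g hg), mul_one]
  · rintro ⟨f, g, hg, h⟩
    refine ⟨f, g, hg, ?_⟩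
    rw [← h, mul_right_comm, PowerSeries.mul_inv_cancel _ (key g hg), one_mul]

/-- A rational series lies in a finite-dimensional space stable under the shift. -/
theorem IsRational.exists_fg {A : PowerSeries K} (hA : IsRational A) :
    ∃ V : Submodule K (PowerSeries K), V.FG ∧ A ∈ V ∧ ∀ B ∈ V, shift B ∈ V := by
  obtain ⟨f, g, hg, h⟩ := isRational_iff_mul.mp hA
  have hg0 : (g : PowerSeries K) ≠ 0 := fun e => hg (by
    rw [← Polynomial.coeff_coe, e, map_zero])
  -- If `g * B` has degree at most `N`, so has `g * shift B`, because `X * (g * shift B) = g * B -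
  -- B(0) * g`.
  set N := max f.natDegree g.natDegree
  refine ⟨_, fg_comap_mulLeft hg0 (polyLE K N), ?_, fun B hB => ?_⟩
  · rw [Submodule.mem_comap, LinearMap.mulLeft_apply, h]
    exact coe_mem_polyLE (le_max_left _ _)
  · rw [Submodule.mem_comap, LinearMap.mulLeft_apply] at hB ⊢
    intro n hn
    have e : X * ((g : PowerSeries K) * shift B) =
        (g : PowerSeries K) * B - (constantCoeff B) • (g : PowerSeries K) := by
      rw [mul_left_comm, X_mul_shift, mul_sub, smul_eq_C_mul, mul_comm (C _)]
    rw [← coeff_succ_X_mul, e, map_sub, hB _ (by omega), coeff_smul,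
      coe_mem_polyLE (le_max_right f.natDegree g.natDegree) _ (by omega), smul_zero, sub_zero]

theorem coeff_shiftLinear_pow (A : PowerSeries K) (k n : ℕ) :
    coeff n ((shiftLinear K ^ k) A) = coeff (n + k) A := by
  induction k generalizing n with
  | zero => simp
  | succ k ih =>
    rw [pow_succ', Module.End.mul_apply, shiftLinear_apply, coeff_shift, ih]
    congr 2
    omega

/-- A member of a finite-dimensional space stable under the shift is rational. -/
theorem isRational_of_fg {A : PowerSeries K} {V : Submodule K (PowerSeries K)} (hV : V.FG)
    (hA : A ∈ V) (hs : ∀ B ∈ V, shift B ∈ V) : IsRational A := by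
  have : Module.Finite K V := Module.Finite.iff_fg.mpr hV
  let T : Module.End K V := (shiftLinear K).restrict hs
  -- A monic equation for the shift on `V` is a linear recurrence for the coefficients of `A`; the
  -- reversed polynomial is then a denominator, with constant term `1`.
  have hT : IsIntegral K T := Algebra.IsIntegral.isIntegral T
  have hTpow (k : ℕ) (B : V) : ((T ^ k) B : PowerSeries K) = (shiftLinear K ^ k) B := by
    induction k with
    | zero => rfl
    | succ k ih => rw [pow_succ', pow_succ', Module.End.mul_apply, Module.End.mul_apply, ← ih]; rfl
  obtain ⟨q, hq, h0⟩ := hT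
  have hrec (n : ℕ) : ∑ k ∈ Finset.range (q.natDegree + 1), q.coeff k * coeff (n + k) A = 0 := by
    have h1 : Polynomial.aeval T q ⟨A, hA⟩ = 0 := by
      rw [Polynomial.aeval_def, h0, LinearMap.zero_apply]
    rw [Polynomial.aeval_eq_sum_range, LinearMap.sum_apply] at h1
    have h2 := congrArg (fun v : V => coeff n (v : PowerSeries K)) h1
    simpa [hTpow, coeff_shiftLinear_pow] using h2
  rw [isRational_iff_mul]
  have hm : (q.reverse : PowerSeries K) * A ∈ polyLE K q.natDegree := by
    intro n hn
    obtain ⟨m, rfl⟩ := Nat.exists_eq_add_of_lt hn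
    rw [← hrec (m + 1), coeff_mul, Finset.Nat.sum_antidiagonal_eq_sum_range_succ
      (fun i j => coeff i (q.reverse : PowerSeries K) * coeff j A)]
    rw [← Finset.sum_subset (s₁ := Finset.range (q.natDegree + 1))
      (Finset.range_subset_range.mpr (by omega)), ← Finset.sum_range_reflect]
    · refine Finset.sum_congr rfl fun k hk => ?_
      rw [Finset.mem_range] at hk
      rw [Polynomial.coeff_coe, Polynomial.coeff_reverse, Polynomial.revAt_le (by omega)]
      congr 3 <;> omega
    · intro k _ hk
      rw [Finset.mem_range] at hk
      rw [coe_mem_polyLE q.reverse_natDegree_le k (by omega), zero_mul]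
  obtain ⟨f, hf⟩ := exists_coe_eq_of_mem_polyLE hm
  refine ⟨f, q.reverse, ?_, hf.symm⟩
  rw [Polynomial.coeff_zero_reverse, hq.leadingCoeff]
  exact one_ne_zero

theorem isRational_shift {A : PowerSeries K} (hA : IsRational A) : IsRational (shift A) := by
  obtain ⟨V, hV, hAV, hs⟩ := hA.exists_fg
  exact isRational_of_fg hV (hs A hAV) hs

/-- By the Leibniz rule, the span of the products of two shift-stable spaces is shift-stable. -/
theorem isRational_shuffle {A B : PowerSeries K} (hA : IsRational A) (hB : IsRational B) :
    IsRational (shuffle A B) := by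
  obtain ⟨V, hV, hAV, hVs⟩ := hA.exists_fg
  obtain ⟨W, hW, hBW, hWs⟩ := hB.exists_fg
  have key : V.map₂ (shuffleBilin K) W ≤
      (V.map₂ (shuffleBilin K) W).comap (shiftLinear K) := by
    rw [Submodule.map₂_le]
    intro D hD E hE
    rw [Submodule.mem_comap, shiftLinear_apply, shuffleBilin_apply, shift_shuffle]
    exact add_mem (Submodule.apply_mem_map₂ (shuffleBilin K) (hVs D hD) hE)
      (Submodule.apply_mem_map₂ (shuffleBilin K) hD (hWs E hE))
  exact isRational_of_fg (hV.map₂ (shuffleBilin K) hW)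
    (Submodule.apply_mem_map₂ (shuffleBilin K) hAV hBW) fun D hD => key hD

theorem isRational_one : IsRational (1 : PowerSeries K) :=
  ⟨1, 1, by simp, by simp⟩

theorem isRational_shufflePow {A : PowerSeries K} (hA : IsRational A) (n : ℕ) :
    IsRational (shufflePow A n) := by
  induction n with
  | zero => exact isRational_one
  | succ n ih => exact isRational_shuffle hA ih

theorem IsRational.C_add_X_mul {A : PowerSeries K} (hA : IsRational A) (c : K) :
    IsRational (C c + X * A) := by
  rw [isRational_iff_mul] at hA ⊢
  obtain ⟨f, g, hg, h⟩ := hA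
  refine ⟨Polynomial.C c * g + Polynomial.X * f, g, hg, ?_⟩
  simp only [Polynomial.coe_add, Polynomial.coe_mul, Polynomial.coe_C, Polynomial.coe_X, ← h]
  ring

end Rational

/-! ### Cartier operators and the shuffle product -/

section Cartier

variable {K : Type*} [Field K] {p : ℕ} [Fact p.Prime] [CharP K p]

theorem coeff_pow_char (A : PowerSeries K) (n : ℕ) :
    coeff n (A ^ p) = if p ∣ n then coeff (n / p) A ^ p else 0 := by
  have hp : p ≠ 0 := (Fact.out : p.Prime).ne_zero
  have h : PowerSeries.map (frobenius K p) (A.expand p hp) = A ^ p :=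
    MvPowerSeries.map_frobenius_expand p hp
  rw [← h, coeff_map, coeff_expand]
  split_ifs
  · rfl
  · exact map_zero _

theorem coeff_X_pow_mul_pow_char (A : PowerSeries K) {r s : ℕ} (hr : r < p) (hs : s < p) (n : ℕ) :
    coeff (p * n + r) (X ^ s * A ^ p) = if s = r then coeff n A ^ p else 0 := by
  have hp : 0 < p := by omega
  rw [coeff_X_pow_mul', coeff_pow_char]
  by_cases h : s = r
  · subst h
    rw [if_pos (by omega), if_pos rfl, Nat.add_sub_cancel, if_pos (dvd_mul_right _ _),
      Nat.mul_div_cancel_left _ hp]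
  · rw [if_neg h]
    split_ifs with h1 h2
    · exfalso
      obtain ⟨k, hk⟩ := h2
      have h3 : p * n + r = p * k + s := by omega
      have h4 := congrArg (· % p) h3
      simp only [Nat.mul_add_mod, Nat.mod_eq_of_lt hr, Nat.mod_eq_of_lt hs] at h4
      exact h h4.symm
    · rfl
    · rfl

/-- Lucas' theorem, with only the last base-`p` digit split off. -/
theorem cast_choose_mul_add {r s : ℕ} (hr : r < p) (hs : s < p) (n u : ℕ) :
    (((p * n + r).choose (p * u + s) : ℕ) : K) = (r.choose s : ℕ) * (n.choose u : ℕ) := by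
  have hp : 0 < p := by omega
  have h := Choose.choose_modEq_choose_mod_mul_choose_div_nat (n := p * n + r) (k := p * u + s)
    (p := p)
  rw [CharP.natCast_eq_natCast' K p h, Nat.mul_add_mod, Nat.mul_add_mod, Nat.mod_eq_of_lt hr, Nat.mod_eq_of_lt hs,
    Nat.mul_add_div hp, Nat.mul_add_div hp, Nat.div_eq_of_lt hr, Nat.div_eq_of_lt hs]
  simp

variable (p) [PerfectRing K p]

/-- The Cartier operators: the `n`-th coefficient of `cartier p r A` is the `p`-th root of the
coefficient of `X ^ (p * n + r)` in `A`. -/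
noncomputable def cartier (r : ℕ) (A : PowerSeries K) : PowerSeries K :=
  PowerSeries.mk fun n => (frobeniusEquiv K p).symm (coeff (p * n + r) A)

theorem coeff_cartier (r n : ℕ) (A : PowerSeries K) :
    coeff n (cartier p r A) = (frobeniusEquiv K p).symm (coeff (p * n + r) A) :=
  coeff_mk _ _

theorem cartier_add (r : ℕ) (A B : PowerSeries K) :
    cartier p r (A + B) = cartier p r A + cartier p r B := by
  ext n
  simp only [coeff_cartier, map_add]

theorem cartier_smul (r : ℕ) (c : K) (A : PowerSeries K) :
    cartier p r (c • A) = (frobeniusEquiv K p).symm c • cartier p r A := by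
  ext n
  simp only [coeff_cartier, coeff_smul, map_mul, smul_eq_mul]

/-- The Cartier operators as semilinear maps. -/
noncomputable def cartierLinear (r : ℕ) :
    PowerSeries K →ₛₗ[((frobeniusEquiv K p).symm : K →+* K)] PowerSeries K where
  toFun := cartier p r
  map_add' := cartier_add p r
  map_smul' := cartier_smul p r

theorem cartierLinear_apply (r : ℕ) (A : PowerSeries K) :
    cartierLinear p r A = cartier p r A := rfl

theorem cartier_mem_polyLE {A : PowerSeries K} {N : ℕ} (hA : A ∈ polyLE K (p * N)) (r : ℕ) :
    cartier p r A ∈ polyLE K N := by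
  intro n hn
  have hp : 0 < p := (Fact.out : p.Prime).pos
  have : p * N < p * n := Nat.mul_lt_mul_of_pos_left hn hp
  rw [coeff_cartier, hA _ (by omega), map_zero]

theorem cartier_sum {r : ℕ} (hr : r < p) (D : ℕ → PowerSeries K) :
    cartier p r (∑ s ∈ Finset.range p, X ^ s * D s ^ p) = D r := by
  ext n
  rw [coeff_cartier, map_sum, Finset.sum_eq_single r, coeff_X_pow_mul_pow_char _ hr hr,
    if_pos rfl]
  · exact frobeniusEquiv_symm_apply_frobenius K p _
  · intro s hs hsr
    rw [coeff_X_pow_mul_pow_char _ hr (Finset.mem_range.mp hs), if_neg hsr]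
  · intro h
    exact absurd (Finset.mem_range.mpr hr) h

theorem eq_sum_cartier (A : PowerSeries K) :
    A = ∑ s ∈ Finset.range p, X ^ s * cartier p s A ^ p := by
  ext m
  have hr : m % p < p := Nat.mod_lt _ (Fact.out : p.Prime).pos
  conv_lhs => rw [← Nat.div_add_mod m p]
  conv_rhs => rw [← Nat.div_add_mod m p]
  rw [map_sum, Finset.sum_eq_single (m % p), coeff_X_pow_mul_pow_char _ hr hr, if_pos rfl,
    coeff_cartier, frobeniusEquiv_symm_pow_p]
  · intro s hs hsr
    rw [coeff_X_pow_mul_pow_char _ hr (Finset.mem_range.mp hs), if_neg hsr]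
  · intro h
    exact absurd (Finset.mem_range.mpr hr) h

/-- In the decomposition `A = ∑ X ^ s * (cartier p s A) ^ p`, the factor `B ^ p` is absorbed into
the `p`-th powers. -/
theorem cartier_mul_pow {r : ℕ} (hr : r < p) (A B : PowerSeries K) :
    cartier p r (A * B ^ p) = cartier p r A * B := by
  conv_lhs => rw [eq_sum_cartier p A, Finset.sum_mul]
  rw [← cartier_sum p hr fun s => cartier p s A * B]
  congr 1
  exact Finset.sum_congr rfl fun s _ => by rw [mul_pow, mul_assoc]

theorem exists_cartier_ne_zero {A : PowerSeries K} (hA : A ≠ 0) :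
    ∃ r < p, cartier p r A ≠ 0 := by
  by_contra! h
  refine hA ?_
  rw [eq_sum_cartier p A]
  refine Finset.sum_eq_zero fun s hs => ?_
  rw [h s (Finset.mem_range.mp hs), zero_pow (Fact.out : p.Prime).ne_zero, mul_zero]

/-- Lucas' theorem factors the binomial coefficients and kills every pair `(i, j)` whose addition
carries out of the last digit; the others split into last digits `(s, t)` and quotients `(u, v)`. -/
theorem cartier_shuffle {r : ℕ} (hr : r < p) (A B : PowerSeries K) :
    cartier p r (shuffle A B) = ∑ st ∈ Finset.HasAntidiagonal.antidiagonal r,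
      ((r.choose st.1 : ℕ) : K) • shuffle (cartier p st.1 A) (cartier p st.2 B) := by
  have hp : 0 < p := by omega
  ext n
  simp only [coeff_cartier, coeff_shuffle, map_sum, coeff_smul, smul_eq_mul,
    Finset.mul_sum, map_mul, map_natCast]
  rw [← Finset.sum_product']
  symm
  refine Finset.sum_of_injOn (fun x => (p * x.2.1 + x.1.1, p * x.2.2 + x.1.2)) ?_ ?_ ?_ ?_
  · rintro ⟨⟨s, t⟩, u, v⟩ h ⟨⟨s', t'⟩, u', v'⟩ h' e
    simp only [Finset.coe_product, Set.mem_prod, Finset.mem_coe,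
      Finset.HasAntidiagonal.mem_antidiagonal, Prod.mk.injEq] at h h' e ⊢
    have key : ∀ {a b c d : ℕ}, b < p → d < p → p * a + b = p * c + d → a = c ∧ b = d := by
      intro a b c d hb hd hh
      have h1 := congrArg (· % p) hh
      have h2 := congrArg (· / p) hh
      simp only [Nat.mul_add_mod, Nat.mod_eq_of_lt hb, Nat.mod_eq_of_lt hd] at h1
      simp only [Nat.mul_add_div hp, Nat.div_eq_of_lt hb, Nat.div_eq_of_lt hd] at h2
      exact ⟨h2, h1⟩
    have h1 := key (by omega) (by omega) e.1
    have h2 := key (by omega) (by omega) e.2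
    exact ⟨⟨h1.2, h2.2⟩, h1.1, h2.1⟩
  · rintro ⟨⟨s, t⟩, u, v⟩ h
    simp only [Finset.coe_product, Set.mem_prod, Finset.mem_coe,
      Finset.HasAntidiagonal.mem_antidiagonal] at h ⊢
    rw [← h.1, ← h.2]
    ring
  · rintro ⟨i, j⟩ h h'
    rw [Finset.HasAntidiagonal.mem_antidiagonal] at h
    have hi := Nat.div_add_mod i p
    have his : i % p < p := Nat.mod_lt _ hp
    have hc := cast_choose_mul_add (K := K) hr his n (i / p)
    rw [hi] at hc
    dsimp only at h ⊢
    rw [hc]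
    -- If neither Lucas factor vanishes, there is no carry and `(i, j)` is in the image of the
    -- splitting.
    rcases lt_or_ge r (i % p) with h1 | h1
    · rw [Nat.choose_eq_zero_of_lt h1]
      simp
    · rcases lt_or_ge n (i / p) with h2 | h2
      · rw [Nat.choose_eq_zero_of_lt h2]
        simp
      · refine absurd ⟨((i % p, r - i % p), (i / p, n - i / p)), ?_, ?_⟩ h'
        · simp only [Finset.coe_product, Set.mem_prod, Finset.mem_coe,
            Finset.HasAntidiagonal.mem_antidiagonal]
          omega
        · simp only [Prod.mk.injEq]
          refine ⟨hi, ?_⟩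
          rw [Nat.mul_sub]
          have : p * (i / p) ≤ p * n := Nat.mul_le_mul_left p h2
          omega
  · rintro ⟨⟨s, t⟩, u, v⟩ h
    simp only [Finset.mem_product, Finset.HasAntidiagonal.mem_antidiagonal] at h ⊢
    rw [cast_choose_mul_add hr (by omega)]
    ring

/-- The property of lying in a finite-dimensional space stable under the Cartier operators. -/
def IsCartierFinite (A : PowerSeries K) : Prop :=
  ∃ V : Submodule K (PowerSeries K), V.FG ∧ A ∈ V ∧ ∀ r < p, ∀ B ∈ V, cartier p r B ∈ V

variable {p}

/-- The preimage of a subspace under a semilinear map is a subspace, so stability need only be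
checked on the products `D ⋆ E`. -/
theorem isCartierFinite_shuffle {A B : PowerSeries K} (hA : IsCartierFinite p A)
    (hB : IsCartierFinite p B) : IsCartierFinite p (shuffle A B) := by
  obtain ⟨V, hV, hAV, hVs⟩ := hA
  obtain ⟨W, hW, hBW, hWs⟩ := hB
  have key (r : ℕ) (hr : r < p) : V.map₂ (shuffleBilin K) W ≤
      (V.map₂ (shuffleBilin K) W).comap (cartierLinear p r) := by
    rw [Submodule.map₂_le]
    intro D hD E hE
    rw [Submodule.mem_comap, cartierLinear_apply, shuffleBilin_apply, cartier_shuffle p hr]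
    refine sum_mem fun st h => Submodule.smul_mem _ _ ?_
    rw [Finset.HasAntidiagonal.mem_antidiagonal] at h
    exact Submodule.apply_mem_map₂ (shuffleBilin K) (hVs _ (by omega) D hD)
      (hWs _ (by omega) E hE)
  exact ⟨_, hV.map₂ (shuffleBilin K) hW, Submodule.apply_mem_map₂ (shuffleBilin K) hAV hBW,
    fun r hr D hD => key r hr hD⟩

end Cartier

section Algebraic

/-! ### Algebraic series and Cartier-stable spaces -/

variable {K : Type*} [Field K]

theorem isAlgebraicSeries_iff {A : PowerSeries K} :
    IsAlgebraicSeries A ↔ IsAlgebraic (Polynomial K) A := Iff.rfl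

theorem polynomial_smul_eq (f : Polynomial K) (A : PowerSeries K) :
    f • A = (f : PowerSeries K) * A := Algebra.smul_def f A

/-- The powers `A ^ q ^ i` of an algebraic series are linearly dependent over the polynomials. -/
theorem exists_relation_of_isAlgebraic (q : ℕ) {A : PowerSeries K}
    (hA : IsAlgebraicSeries A) :
    ∃ (N h : ℕ) (P : ℕ → PowerSeries K), (∀ i, P i ∈ polyLE K N) ∧ (∃ i ≤ h, P i ≠ 0) ∧
      ∑ i ∈ Finset.range (h + 1), P i * A ^ q ^ i = 0 := by
  -- The multiple `y • A` is integral, hence generates a Noetherian module over the polynomials, in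
  -- which infinitely many powers must be dependent.
  obtain ⟨y, hy0, hy⟩ := (isAlgebraicSeries_iff.mp hA).exists_integral_multiple
  have : Module.Finite (Polynomial K) (Algebra.adjoin (Polynomial K) {y • A}) :=
    Module.Finite.iff_fg.mpr hy.fg_adjoin_singleton
  have : IsNoetherian (Polynomial K) (Algebra.adjoin (Polynomial K) {y • A}) :=
    isNoetherian_of_isNoetherianRing_of_finite _ _
  let a : Algebra.adjoin (Polynomial K) {y • A} :=
    ⟨y • A, Algebra.self_mem_adjoin_singleton _ _⟩
  have hdep : ¬ LinearIndependent (Polynomial K) fun i : ℕ => a ^ q ^ i := fun h =>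
    not_finite_iff_infinite.mpr (inferInstance : Infinite ℕ) h.finite_of_isNoetherian
  obtain ⟨s, g, hg, j, hj, hj0⟩ := not_linearIndependent_iff.mp hdep
  let P : ℕ → Polynomial K := fun i => if i ∈ s then g i * y ^ q ^ i else 0
  refine ⟨s.sup fun i => (P i).natDegree, s.sup id, fun i => P i, fun i => ?_,
    ⟨j, Finset.le_sup (f := id) hj, ?_⟩, ?_⟩
  · by_cases hi : i ∈ s
    · exact coe_mem_polyLE (Finset.le_sup (f := fun i => (P i).natDegree) hi)
    · simp only [P, if_neg hi, Polynomial.coe_zero]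
      exact zero_mem _
  · simp only [P, if_pos hj]
    rw [Ne, Polynomial.coe_eq_zero_iff]
    exact mul_ne_zero hj0 (pow_ne_zero _ hy0)
  · have h1 := congrArg Subtype.val hg
    rw [AddSubmonoidClass.coe_finsetSum] at h1
    rw [← Finset.sum_subset (s₁ := s)]
    · refine Eq.trans (Finset.sum_congr rfl fun i hi => ?_) h1
      simp only [P, if_pos hi, a, SetLike.val_smul, SubmonoidClass.coe_pow, polynomial_smul_eq,
        Polynomial.coe_mul, Polynomial.coe_pow, mul_pow, mul_assoc]
    · intro i hi
      exact Finset.mem_range.mpr (Nat.lt_succ_of_le (Finset.le_sup (f := id) hi))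
    · intro i _ hi
      simp only [P, if_neg hi, Polynomial.coe_zero, zero_mul]

variable {p : ℕ} [Fact p.Prime] [CharP K p]

/-- Powers `B ^ p ^ i` of elements of a space are combinations of the powers of generators. -/
theorem pow_mem_span_image {b : Set (PowerSeries K)} (i : ℕ) {B : PowerSeries K}
    (hB : B ∈ Submodule.span K b) :
    B ^ p ^ i ∈ Submodule.span (Polynomial K) ((· ^ p ^ i) '' b) := by
  have hp : p.Prime := Fact.out
  have : CharP (PowerSeries K) p := charP_of_injective_ringHom C_injective p
  induction hB using Submodule.span_induction with
  | mem B hB => exact Submodule.subset_span (Set.mem_image_of_mem _ hB)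
  | zero =>
    rw [zero_pow (pow_ne_zero _ hp.ne_zero)]
    exact zero_mem _
  | add B D _ _ hB hD =>
    rw [add_pow_char_pow]
    exact add_mem hB hD
  | smul c B _ hB =>
    have e : (c • B) ^ p ^ i = Polynomial.C (c ^ p ^ i) • B ^ p ^ i := by
      rw [smul_pow, polynomial_smul_eq, Polynomial.coe_C, smul_eq_C_mul]
    rw [e]
    exact Submodule.smul_mem _ _ hB

variable [PerfectRing K p]

/-- Applying Cartier operators, one reaches a relation whose coefficient of `A` is nonzero. -/
theorem exists_relation_zero_ne_zero {A : PowerSeries K} {N : ℕ} (h : ℕ) (P : ℕ → PowerSeries K)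
    (hP : ∀ i, P i ∈ polyLE K N) (hne : ∃ i ≤ h, P i ≠ 0)
    (hrel : ∑ i ∈ Finset.range (h + 1), P i * A ^ p ^ i = 0) :
    ∃ (h : ℕ) (P : ℕ → PowerSeries K), (∀ i, P i ∈ polyLE K N) ∧ P 0 ≠ 0 ∧
      ∑ i ∈ Finset.range (h + 1), P i * A ^ p ^ i = 0 := by
  induction h generalizing P with
  | zero =>
    obtain ⟨i, hi, hi0⟩ := hne
    obtain rfl : i = 0 := by omega
    exact ⟨0, P, hP, hi0, hrel⟩
  | succ h ih =>
    by_cases h0 : P 0 = 0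
    · obtain ⟨i, hi, hi0⟩ := hne
      obtain ⟨j, rfl⟩ : ∃ j, i = j + 1 :=
        Nat.exists_eq_succ_of_ne_zero fun e => hi0 (e ▸ h0)
      obtain ⟨r, hr, hr0⟩ := exists_cartier_ne_zero p hi0
      -- With `P 0 = 0`, every remaining `A ^ p ^ (i + 1)` is a `p`-th power, so the operator lowers
      -- each exponent one step; `r` is chosen to keep a nonzero coefficient.
      refine ih (fun i => cartier p r (P (i + 1)))
        (fun i => cartier_mem_polyLE p (polyLE_mono
          (Nat.le_mul_of_pos_left N (Fact.out : p.Prime).pos) (hP _)) r)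
        ⟨j, by omega, hr0⟩ ?_
      rw [Finset.sum_range_succ', h0, zero_mul, add_zero] at hrel
      have h1 := congrArg (cartierLinear p r) hrel
      rw [map_sum, map_zero] at h1
      rw [← h1]
      refine Finset.sum_congr rfl fun i _ => ?_
      rw [cartierLinear_apply, pow_succ, pow_mul, cartier_mul_pow p hr]
    · exact ⟨h + 1, P, hP, h0, hrel⟩

/-- The combinations of `A ^ q ^ i` for `i ≤ h` with polynomials of degree at most `N`
as coefficients. -/
noncomputable def combination (A : PowerSeries K) (q h N : ℕ) :
    (Fin (h + 1) → polyLE K N) →ₗ[K] PowerSeries K :=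
  ∑ i : Fin (h + 1), LinearMap.mulRight K (A ^ q ^ (i : ℕ)) ∘ₗ (polyLE K N).subtype ∘ₗ
    LinearMap.proj i

theorem mem_range_combination {A B : PowerSeries K} {q h N : ℕ} :
    B ∈ LinearMap.range (combination A q h N) ↔ ∃ c : ℕ → PowerSeries K,
      (∀ i, c i ∈ polyLE K N) ∧ B = ∑ i ∈ Finset.range (h + 1), c i * A ^ q ^ i := by
  simp only [LinearMap.mem_range, combination, LinearMap.sum_apply, LinearMap.comp_apply,
    LinearMap.proj_apply, LinearMap.mulRight_apply, Submodule.subtype_apply]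
  constructor
  · rintro ⟨c, rfl⟩
    refine ⟨fun i => if hi : i < h + 1 then c ⟨i, hi⟩ else 0, fun i => ?_, ?_⟩
    · dsimp only
      split_ifs with hi
      · exact (c ⟨i, hi⟩).2
      · exact zero_mem _
    · rw [Finset.sum_range]
      exact Finset.sum_congr rfl fun i _ => by simp only [dif_pos i.2]
  · rintro ⟨c, hc, rfl⟩
    exact ⟨fun i => ⟨c i, hc i⟩, by rw [Finset.sum_range]⟩

/-- An algebraic series lies in a finite-dimensional space stable under the Cartier operators. -/
theorem isCartierFinite_of_isAlgebraic {A : PowerSeries K} (hA : IsAlgebraicSeries A) :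
    IsCartierFinite p A := by
  have hp : p.Prime := Fact.out
  obtain ⟨N, h₀, P₀, hP₀, hne, hrel₀⟩ := exists_relation_of_isAlgebraic p hA
  obtain ⟨h, P, hP, h0, hrel⟩ := exists_relation_zero_ne_zero h₀ P₀ hP₀ hne hrel₀
  -- The stable space consists of the `B` for which `P 0 * B` is a combination of the `A ^ p ^ i`,
  -- `i ≤ h`, with coefficients of degree at most `N`.
  refine ⟨_, fg_comap_mulLeft h0 (LinearMap.range (combination A p h N)), ?_,
    fun r hr B hB => ?_⟩
  · rw [Submodule.mem_comap, LinearMap.mulLeft_apply, mem_range_combination]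
    refine ⟨fun i => if i = 0 then P 0 else 0, fun i => ?_, ?_⟩
    · dsimp only
      split_ifs
      · exact hP 0
      · exact zero_mem _
    · rw [Finset.sum_eq_single 0]
      · simp
      · intro i _ hi
        simp only [if_neg hi, zero_mul]
      · simp
  · rw [Submodule.mem_comap, LinearMap.mulLeft_apply, mem_range_combination] at hB ⊢
    obtain ⟨c, hc, hB⟩ := hB
    obtain ⟨q, rfl⟩ : ∃ q, p = q + 2 := ⟨p - 2, by have := hp.two_le; omega⟩
    -- Multiplying `P 0 * B` by `P 0 ^ (p - 1)` makes the denominator a `p`-th power; subtracting `c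
    -- 0 * P 0 ^ (p - 2)` times the relation removes the term in `A`, the only one that is not a
    -- `p`-th power. The degrees stay within `p * N`, which the operator brings back to `N`.
    set d : ℕ → PowerSeries K := fun i => P 0 ^ (q + 1) * c i - c 0 * P 0 ^ q * P i with hd
    have hdN (i : ℕ) : d i ∈ polyLE K ((q + 2) * N) := by
      refine sub_mem ?_ ?_
      · exact polyLE_mono (by ring_nf; rfl) (mul_mem_polyLE (pow_mem_polyLE (hP 0) _) (hc i))
      · exact polyLE_mono (by ring_nf; rfl)
          (mul_mem_polyLE (mul_mem_polyLE (hc 0) (pow_mem_polyLE (hP 0) _)) (hP i))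
    have hd0 : d 0 = 0 := by
      simp only [hd]
      ring
    have e : B * P 0 ^ (q + 2) =
        ∑ i ∈ Finset.range h, d (i + 1) * (A ^ (q + 2) ^ i) ^ (q + 2) := by
      have e1 : B * P 0 ^ (q + 2) = P 0 ^ (q + 1) * (P 0 * B) -
          c 0 * P 0 ^ q * ∑ i ∈ Finset.range (h + 1), P i * A ^ (q + 2) ^ i := by
        rw [hrel]
        ring
      rw [e1, hB, Finset.mul_sum, Finset.mul_sum, ← Finset.sum_sub_distrib]
      have e2 (i : ℕ) : P 0 ^ (q + 1) * (c i * A ^ (q + 2) ^ i) -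
          c 0 * P 0 ^ q * (P i * A ^ (q + 2) ^ i) = d i * A ^ (q + 2) ^ i := by
        simp only [hd]
        ring
      simp only [e2]
      rw [Finset.sum_range_succ', hd0, zero_mul, add_zero]
      simp only [pow_succ (q + 2), pow_mul A]
    have e' := congrArg (cartierLinear (q + 2) r) e
    rw [cartierLinear_apply, cartier_mul_pow _ hr, map_sum] at e'
    refine ⟨fun i => if i < h then cartier (q + 2) r (d (i + 1)) else 0, fun i => ?_, ?_⟩
    · dsimp only
      split_ifs
      · exact cartier_mem_polyLE _ (hdN _) r
      · exact zero_mem _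
    · simp only [mul_comm (P 0), e', Finset.sum_range_succ, lt_irrefl, if_false, zero_mul, add_zero]
      refine Finset.sum_congr rfl fun i hi => ?_
      rw [if_pos (Finset.mem_range.mp hi), cartierLinear_apply, cartier_mul_pow _ hr]

/-- A member of a finite-dimensional space stable under the Cartier operators is algebraic. -/
theorem isAlgebraic_of_isCartierFinite {A : PowerSeries K} (hA : IsCartierFinite p A) :
    IsAlgebraicSeries A := by
  classical
  have hp : p.Prime := Fact.out
  have : CharP (PowerSeries K) p := charP_of_injective_ringHom C_injective p
  obtain ⟨V, ⟨b, rfl⟩, hAV, hV⟩ := hA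
  let M (i : ℕ) : Submodule (Polynomial K) (PowerSeries K) :=
    Submodule.span (Polynomial K) ((· ^ p ^ i) '' (b : Set (PowerSeries K)))
  -- Raising the Cartier decomposition of a generator to the power `p ^ i` puts it in the next
  -- module.
  have hM : Monotone M := by
    refine monotone_nat_of_le_succ fun i => Submodule.span_le.mpr ?_
    rintro _ ⟨B, hB, rfl⟩
    have e : B ^ p ^ i = ∑ s ∈ Finset.range p,
        ((Polynomial.X : Polynomial K) ^ s) ^ p ^ i • cartier p s B ^ p ^ (i + 1) := by
      conv_lhs => rw [eq_sum_cartier p B, sum_pow_char_pow]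
      refine Finset.sum_congr rfl fun s _ => ?_
      rw [mul_pow, polynomial_smul_eq, pow_succ' p, pow_mul (cartier p s B)]
      simp
    simp only [SetLike.mem_coe, e]
    refine sum_mem fun s hs => Submodule.smul_mem _ _ (pow_mem_span_image _ ?_)
    exact hV s (Finset.mem_range.mp hs) B (Submodule.subset_span hB)
  set d := b.card
  -- All `d + 1` powers lie in `M d`, which has at most `d` generators.
  let v : Fin (d + 1) → PowerSeries K := fun i => A ^ p ^ (i : ℕ)
  have hdep : ¬ LinearIndependent (Polynomial K) v := by
    intro hli
    have hv (i : Fin (d + 1)) : v i ∈ Submodule.span (Polynomial K)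
        ((b.image (· ^ p ^ d) : Finset (PowerSeries K)) : Set (PowerSeries K)) := by
      rw [Finset.coe_image]
      exact hM (Nat.lt_succ_iff.mp i.2) (pow_mem_span_image _ hAV)
    let w : Fin (d + 1) → Submodule.span (Polynomial K)
        ((b.image (· ^ p ^ d) : Finset (PowerSeries K)) : Set (PowerSeries K)) :=
      fun i => ⟨v i, hv i⟩
    have hw : LinearIndependent (Polynomial K) w :=
      LinearIndependent.of_comp (Submodule.subtype _) hli
    have h1 := hw.fintype_card_le_finrank
    have h2 := finrank_span_finset_le_card (R := Polynomial K) (b.image (· ^ p ^ d))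
    rw [Fintype.card_fin] at h1
    have h3 : (b.image (· ^ p ^ d)).card ≤ d := Finset.card_image_le
    exact absurd (h1.trans (h2.trans h3)) (by omega)
  obtain ⟨g, hg, j, hj⟩ := Fintype.not_linearIndependent_iff.mp hdep
  refine isAlgebraicSeries_iff.mpr
    ⟨∑ i : Fin (d + 1), Polynomial.monomial (p ^ (i : ℕ)) (g i), fun h0 => hj ?_, ?_⟩
  -- The exponents `p ^ i` are distinct, so no coefficients `g i` merge.
  · have h1 := congrArg (fun P => Polynomial.coeff P (p ^ (j : ℕ))) h0
    simp only [Polynomial.finsetSum_coeff, Polynomial.coeff_monomial,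
      Nat.pow_right_inj hp.one_lt, Polynomial.coeff_zero, Fin.val_inj] at h1
    simpa using h1
  · rw [map_sum, ← hg]
    exact Finset.sum_congr rfl fun i _ => by rw [Polynomial.aeval_monomial, Algebra.smul_def]

theorem isAlgebraicSeries_shuffle (p : ℕ) [Fact p.Prime] [CharP K p] [PerfectRing K p]
    {A B : PowerSeries K} (hA : IsAlgebraicSeries A)
    (hB : IsAlgebraicSeries B) : IsAlgebraicSeries (shuffle A B) :=
  isAlgebraic_of_isCartierFinite (p := p) (isCartierFinite_shuffle
    (isCartierFinite_of_isAlgebraic hA) (isCartierFinite_of_isAlgebraic hB))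

theorem isAlgebraicSeries_shufflePow (p : ℕ) [Fact p.Prime] [CharP K p] [PerfectRing K p]
    {A : PowerSeries K} (hA : IsAlgebraicSeries A) (n : ℕ) :
    IsAlgebraicSeries (shufflePow A n) := by
  induction n with
  | zero => exact isAlgebraicSeries_iff.mpr isAlgebraic_one
  | succ n ih => exact isAlgebraicSeries_shuffle p hA ih

theorem isAlgebraicSeries_coe (f : Polynomial K) : IsAlgebraicSeries (f : PowerSeries K) :=
  isAlgebraicSeries_iff.mpr (isAlgebraic_algebraMap f)

theorem isAlgebraicSeries_C_add_X_mul {A : PowerSeries K} (hA : IsAlgebraicSeries A) (c : K) :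
    IsAlgebraicSeries (C c + X * A) := by
  have hC := isAlgebraicSeries_coe (Polynomial.C c)
  have hX := isAlgebraicSeries_coe (Polynomial.X : Polynomial K)
  rw [Polynomial.coe_C] at hC
  rw [Polynomial.coe_X] at hX
  exact IsAlgebraic.add hC (IsAlgebraic.mul hX hA)

theorem isAlgebraicSeries_shift {A : PowerSeries K} (hA : IsAlgebraicSeries A) :
    IsAlgebraicSeries (shift A) := by
  have hC := isAlgebraicSeries_coe (Polynomial.C (constantCoeff A))
  have hX := isAlgebraicSeries_coe (Polynomial.X : Polynomial K)
  rw [Polynomial.coe_C] at hC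
  rw [Polynomial.coe_X] at hX
  refine IsAlgebraic.of_mul (mem_nonZeroDivisors_of_ne_zero X_ne_zero) hX ?_
  rw [X_mul_shift]
  exact IsAlgebraic.sub hA hC

end Algebraic

/-- The form `σ` in terms of the shuffle product over the residue field. -/
theorem sigma_eq (p : ℕ) [Fact p.Prime] (A : PowerSeries (FpBar p)) :
    sigma p A = C (constantCoeff A ^ p) + X * shuffle (shift A) (shufflePow A (p - 1)) := by
  rw [sigma_eq_iff]
  obtain ⟨φ⟩ := exists_reduction p
  choose l hl using reduction_surjective p φ
  have hA : PowerSeries.map φ (PowerSeries.mk fun n => l (coeff n A)) = A := by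
    ext n
    simp [hl]
  set A' : PowerSeries AlgInt := PowerSeries.mk fun n => l (coeff n A)
  obtain ⟨k, hk⟩ : ∃ k, p = k + 1 := ⟨p - 1, by have := (Fact.out : p.Prime).pos; omega⟩
  -- The shift of the `p`-th shuffle power, divided by `p`; the factor `X` undoes the shift.
  refine ⟨φ, A', X * shuffle (shift A') (shufflePow A' (p - 1)), hA, by simp, ?_, ?_⟩
  · have h1 := X_mul_shift (shufflePow A' p)
    have h2 : shift (shufflePow A' p) =
        C (p : AlgInt) * shuffle (shift A') (shufflePow A' (p - 1)) := by
      rw [hk, Nat.add_sub_cancel, shift_shufflePow_succ]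
    have h3 : constantCoeff (shufflePow A' p) = constantCoeff A' ^ p := by
      rw [← coeff_zero_eq_constantCoeff_apply, ← coeff_zero_eq_constantCoeff_apply,
        constantCoeff_shufflePow]
    rw [h2, h3] at h1
    rw [mul_left_comm, h1]
    ring
  · have h0 : φ (constantCoeff A') = constantCoeff A := by
      rw [← hA, ← coeff_zero_eq_constantCoeff_apply, ← coeff_zero_eq_constantCoeff_apply, coeff_map]
    rw [map_add, map_mul, PowerSeries.map_C, PowerSeries.map_X, map_shuffle, map_shift,
      map_shufflePow, hA, map_pow φ, h0]

end ShuffleForm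

theorem mainTheorem4 (p : ℕ) [Fact p.Prime] (A : PowerSeries (AlgebraicClosure (ZMod p))) :
    (ShuffleForm.IsRational A → ShuffleForm.IsRational (ShuffleForm.sigma p A)) ∧
    (ShuffleForm.IsAlgebraicSeries A → ShuffleForm.IsAlgebraicSeries (ShuffleForm.sigma p A)) := by
  rw [ShuffleForm.sigma_eq]
  exact ⟨fun hA => (ShuffleForm.isRational_shuffle (ShuffleForm.isRational_shift hA)
      (ShuffleForm.isRational_shufflePow hA _)).C_add_X_mul _,
    fun hA => ShuffleForm.isAlgebraicSeries_C_add_X_mul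
      (ShuffleForm.isAlgebraicSeries_shuffle p (ShuffleForm.isAlgebraicSeries_shift hA)
        (ShuffleForm.isAlgebraicSeries_shufflePow p hA _)) _⟩
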